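/- **Setting.** Let $d\ge 1$ and let $N=(N_1,\dots,N_d)$ be a multivariate point process on $\mathbb R$, defined on a probability space $(\Omega,\mathcal F,P)$; that is, each $N_i$ is a random locally finite counting measure on $\mathbb R$. Assume that $N$ is stationary, i.e. $(N_1(A_1),\dots,N_d(A_d))$ and $(N_1(t+A_1),\dots,N_d(t+A_d))$ have the same law for all Borel sets $A_1,\dots,A_d\subseteq\mathbb R$ and all $t\in\mathbb R$, and simple, i.e. almost surely all jumps have size one and no two components jump simultaneously. For $A\subseteq\{1,\dots,d\}$ let $\mathcal F_A(t)$ be the $\sigma$-algebra generated by the restrictions of $N_a$, $a\in A$, to $(-\infty,t]$, let $\mathcal F_A(t-)=\bigvee_{s<t}\mathcal F_A(s)$, and write $\mathcal F_{-i}=\mathcal F_{\{1,\dots,d\}\setminus\{i\}}$ and $\mathcal F(t)=\mathcal F_{\{1,\dots,d\}}(t)$. Let $N$ be a multivariate Hawkes process: for each $i$ the component $N_i$ has the conditional intensity $$\lambda_i(t)=\nu_i+\sum_{j=1}^d\int_{(0,\infty)}\varphi_{ij}(u)\,dN_j(t-u),\qquad t\in\mathbb R,$$ where $\nu_i>0$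 and the link functions $\varphi_{ij}:\mathbb R\to[0,\infty)$ are measurable with $\varphi_{ij}(u)=0$ for $u\le 0$ and $\int_0^\infty\varphi_{ij}(u)\,du<1$. Being the conditional intensity of $N_i$ means that $\lambda_i$ is predictable with respect to $(\mathcal F(t))_{t\in\mathbb R}$, is almost surely integrable over bounded intervals, and satisfies $E\int X(t)\lambda_i(t)\,dt=E\int X(t)\,dN_i(t)$ for all non-negative predictable processes $X$. For $i,j\in\{1,\dots,d\}$, $N_i$ does not Granger-cause $N_j$ with respect to $N$ if $\lambda_j(t)$ is $\mathcal F_{-i}(t-)$-measurable for all $t\in\mathbb R$; it does not Granger-cause $N_j$ up to null sets if, for all $t\in\mathbb R$, $\lambda_j(t)$ is almost surely equal to an $\mathcal F_{-i}(t-)$-measurable random variable. **Proposition.** Let $i,j\in\{1,\dots,d\}$. 1. If $\varphi_{ji}$ is left-continuous, then $N_i$ does not Granger-cause $N_j$ with respect to $N$ if and only if $\varphi_{ji}(u)=0$ for all $u\in\mathbb R$; the same equivalence holds for Granger non-causality up to null sets. 2. Without the assumption of left-continuity, $N_i$ does not Granger-cause $N_j$ with respect to $N$ up to null sets if and only if $\varphi_{ji}(u)=0$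 for almost every $u\in\mathbb R$. -/

import Mathlib

open MeasureTheory Set
open scoped ENNReal

namespace Hawkes

variable {Ω : Type*} {d : ℕ}

/-- A locally finite counting measure on the real line. -/
structure IsCountingMeasure (m : Measure ℝ) : Prop where
  locallyFinite : IsLocallyFiniteMeasure m
  integerValued : ∀ B : Set ℝ, MeasurableSet B → ∃ n : ℕ∞, m B = (n : ℝ≥0∞)

/-- A `d`-variate point process on the real line: each component is a random counting measure. -/
structure IsPointProcess [MeasurableSpace Ω] (N : Fin d → Ω → Measure ℝ) : Prop where
  measurable : ∀ i, Measurable (N i)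
  counting : ∀ i ω, IsCountingMeasure (N i ω)

/-- Stationarity: the joint law of `N₁(A₁), …, N_d(A_d)` is invariant under translations. -/
def IsStationary [MeasurableSpace Ω] (P : Measure Ω) (N : Fin d → Ω → Measure ℝ) : Prop :=
  ∀ A : Fin d → Set ℝ, (∀ i, MeasurableSet (A i)) → ∀ t : ℝ,
    P.map (fun ω i => N i ω (A i)) = P.map (fun ω i => N i ω ((fun a => t + a) '' A i))

/-- Simplicity: almost surely all jumps have size one and no two components jump
simultaneously. -/
def IsSimple [MeasurableSpace Ω] (P : Measure Ω) (N : Fin d → Ω → Measure ℝ) : Prop :=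
  ∀ᵐ ω ∂P, ∀ t : ℝ, ∑ i, N i ω {t} ≤ 1

/-- The σ-algebra `F_A(t)` generated by the components `N_a`, `a ∈ A`, on `(-∞, t]`. -/
@[reducible]
noncomputable def history (N : Fin d → Ω → Measure ℝ) (A : Set (Fin d)) (t : ℝ) : MeasurableSpace Ω :=
  ⨆ a ∈ A, MeasurableSpace.comap (fun ω => (N a ω).restrict (Iic t)) inferInstance

/-- The σ-algebra `F_A(t-)` generated by all `F_A(s)`, `s < t`. -/
@[reducible]
noncomputable def historyLeft (N : Fin d → Ω → Measure ℝ) (A : Set (Fin d)) (t : ℝ) : MeasurableSpace Ω :=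
  ⨆ s ∈ Iio t, history N A s

/-- The predictable σ-algebra on `ℝ × Ω` of a family of σ-algebras `(F t)` indexed by `ℝ`
(`MeasureTheory.Filtration.predictable` requires a least time). -/
@[reducible]
def predictable (F : ℝ → MeasurableSpace Ω) : MeasurableSpace (ℝ × Ω) :=
  MeasurableSpace.generateFrom {S | ∃ s A, MeasurableSet[F s] A ∧ S = Ioi s ×ˢ A}

/-- `lam` is the conditional intensity of the component `N i` with respect to the canonical
filtration of the whole process `N`. -/
structure IsConditionalIntensity [MeasurableSpace Ω] (P : Measure Ω)
    (N : Fin d → Ω → Measure ℝ) (i : Fin d) (lam : ℝ → Ω → ℝ≥0∞) : Prop where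
  measurable_predictable : Measurable[predictable (history N univ)] (fun p : ℝ × Ω => lam p.1 p.2)
  locallyIntegrable : ∀ᵐ ω ∂P, ∀ a b : ℝ, ∫⁻ t in Icc a b, lam t ω < ∞
  lintegral_eq : ∀ X : ℝ → Ω → ℝ≥0∞,
    Measurable[predictable (history N univ)] (fun p : ℝ × Ω => X p.1 p.2) →
      ∫⁻ ω, (∫⁻ t, X t ω * lam t ω) ∂P = ∫⁻ ω, (∫⁻ t, X t ω ∂(N i ω)) ∂P

/-- `λ_i(t) = ν_i + ∑_j ∫_{u > 0} φ_ij(u) dN_j(t - u)`, the integral being written in the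
variable `s = t - u < t`. -/
noncomputable def intensity (N : Fin d → Ω → Measure ℝ) (ν : Fin d → ℝ)
    (φ : Fin d → Fin d → ℝ → ℝ) (i : Fin d) (t : ℝ) (ω : Ω) : ℝ≥0∞ :=
  ENNReal.ofReal (ν i) + ∑ j, ∫⁻ s in Iio t, ENNReal.ofReal (φ i j (t - s)) ∂(N j ω)

/-- `N` is a multivariate Hawkes process with baseline intensities `ν` and link functions `φ`. -/
structure IsHawkesProcess [MeasurableSpace Ω] (P : Measure Ω) (N : Fin d → Ω → Measure ℝ)
    (ν : Fin d → ℝ) (φ : Fin d → Fin d → ℝ → ℝ) : Prop where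
  pointProcess : IsPointProcess N
  stationary : IsStationary P N
  simple : IsSimple P N
  baseline_pos : ∀ i, 0 < ν i
  link_measurable : ∀ i j, Measurable (φ i j)
  link_nonneg : ∀ i j u, 0 ≤ φ i j u
  link_eq_zero : ∀ i j u, u ≤ 0 → φ i j u = 0
  link_integral_lt_one : ∀ i j, ∫⁻ u in Ioi (0 : ℝ), ENNReal.ofReal (φ i j u) < 1
  conditionalIntensity : ∀ i, IsConditionalIntensity P N i (intensity N ν φ i)

/-- `N_i` does not Granger-cause the component with conditional intensity `lam`, with respect to
`N`: for every `t`, `lam t` is `F_{-i}(t-)`-measurable. -/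
def GrangerNoncausal (N : Fin d → Ω → Measure ℝ) (i : Fin d) (lam : ℝ → Ω → ℝ≥0∞) : Prop :=
  ∀ t : ℝ, Measurable[historyLeft N {i}ᶜ t] (lam t)

/-- The same notion for the `P`-completed σ-algebras: for every `t`, `lam t` is almost surely equal
to an `F_{-i}(t-)`-measurable random variable. -/
def GrangerNoncausalAE [MeasurableSpace Ω] (P : Measure Ω) (N : Fin d → Ω → Measure ℝ)
    (i : Fin d) (lam : ℝ → Ω → ℝ≥0∞) : Prop :=
  ∀ t : ℝ, ∃ g : Ω → ℝ≥0∞, Measurable[historyLeft N {i}ᶜ t] g ∧ lam t =ᵐ[P] g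

end Hawkes

/-!
The past of the other components does not reveal a recent jump of `N i`. If `λ_j(t)` is
`F_{-i}(t-)`-measurable then, as long as the other components are quiet on `(a, t)`, it is a
function `h` of their past up to `a`, whether or not `N i` jumps in `(a, t)`.

Every event of positive probability that is determined by the history up to `a` remains of positive
probability when intersected with the event of no jump at all in `(a, t]`: until the first jump
after `a` the intensities equal the intensities frozen at time `a`, so that over a short time the
compensator formula makes a jump unlikely, and short times can be chained. Where no component
jumps, `h` is the intensity frozen at `a`; hence the two agree almost surely. So if `N i` has a
point `s` in `(a, t)` while the other components are quiet, its contribution `φ_ji(t - s)` to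
`λ_j(t)` must vanish. Since `ν_i > 0`, such a point falls into any given non-null subset of `(a, t)`
with positive probability, and `φ_ji` vanishes almost everywhere.

Conversely, if `φ_ji` vanishes almost everywhere, then leaving its term out of `λ_j(t)` changes
nothing almost surely, because a null set of times almost surely carries no point of `N i`.
-/

namespace Hawkes

section RandomMeasure

variable {Ω E : Type*} [MeasurableSpace Ω] [MeasurableSpace E]

theorem measurable_restrict_measure {S : Set E} (hS : MeasurableSet S) :
    Measurable fun m : Measure E => m.restrict S := by
  refine Measure.measurable_of_measurable_coe _ fun T hT => ?_
  simpa only [Measure.restrict_apply hT] using Measure.measurable_coe (hT.inter hS)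

variable [TopologicalSpace E] [T2Space E] [SigmaCompactSpace E] [OpensMeasurableSpace E]
  {M : Ω → Measure E}

theorem measurable_apply_prodMk_preimage (hM : Measurable M)
    (hfin : ∀ ω, IsLocallyFiniteMeasure (M ω)) {S : Set (Ω × E)} (hS : MeasurableSet S) :
    Measurable fun ω => M ω (Prod.mk ω ⁻¹' S) := by
  have happly : ∀ ω, M ω (Prod.mk ω ⁻¹' S) =
      ⨆ n, (M ω).restrict (compactCovering E n) (Prod.mk ω ⁻¹' S) := fun ω => by
    rw [← Measure.restrict_iUnion_apply_eq_iSup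
      (directed_of_isDirected_le fun _ _ h => compactCovering_subset E h)
      (measurable_prodMk_left hS), iUnion_compactCovering, Measure.restrict_univ]
  simp only [happly]
  refine .iSup fun n => ?_
  have hK : IsCompact (compactCovering E n) := isCompact_compactCovering E n
  let κ : ProbabilityTheory.Kernel Ω E :=
    ⟨fun ω => (M ω).restrict (compactCovering E n),
      (measurable_restrict_measure hK.measurableSet).comp hM⟩
  exact ProbabilityTheory.Kernel.measurable_kernel_prodMk_left_of_finite (κ := κ) hS
    fun ω => ⟨by simpa [κ] using hK.measure_lt_top⟩

theorem measurable_lintegral_of_locallyFinite (hM : Measurable M)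
    (hfin : ∀ ω, IsLocallyFiniteMeasure (M ω)) {f : Ω → E → ℝ≥0∞}
    (hf : Measurable (Function.uncurry f)) : Measurable fun ω => ∫⁻ u, f ω u ∂M ω := by
  have hmap : Measurable fun ω => (M ω).map (Prod.mk ω) := by
    refine Measure.measurable_of_measurable_coe _ fun S hS => ?_
    simpa only [Measure.map_apply measurable_prodMk_left hS] using
      measurable_apply_prodMk_preimage hM hfin hS
  simpa only [Function.comp_def, Function.uncurry_apply_pair,
    lintegral_map hf measurable_prodMk_left] using (Measure.measurable_lintegral hf).comp hmap

end RandomMeasure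

namespace IsCountingMeasure

variable {m : Measure ℝ}

theorem one_le (hm : IsCountingMeasure m) {B : Set ℝ} (hB : MeasurableSet B) (h : m B ≠ 0) :
    1 ≤ m B := by
  obtain ⟨n, hn⟩ := hm.integerValued B hB
  rw [hn] at h ⊢
  exact_mod_cast Order.one_le_iff_ne_zero.2 (by simpa using h)

theorem restrict (hm : IsCountingMeasure m) {B : Set ℝ} (hB : MeasurableSet B) :
    IsCountingMeasure (m.restrict B) where
  locallyFinite := have := hm.locallyFinite; inferInstance
  integerValued T hT := by
    simpa only [Measure.restrict_apply hT] using hm.integerValued _ (hT.inter hB)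

theorem sum {ι : Type*} [Fintype ι] {m : ι → Measure ℝ} (hm : ∀ i, IsCountingMeasure (m i)) :
    IsCountingMeasure (∑ i, m i) where
  locallyFinite := by
    refine ⟨fun x => ⟨Icc (x - 1) (x + 1), Icc_mem_nhds (by linarith) (by linarith), ?_⟩⟩
    rw [Measure.finsetSum_apply, ENNReal.sum_lt_top]
    intro i _
    have := (hm i).locallyFinite
    exact measure_Icc_lt_top
  integerValued B hB := by
    choose n hn using fun i => (hm i).integerValued B hB
    exact ⟨∑ i, n i, by simp [Measure.finsetSum_apply, hn, ← ENat.toENNRealRingHom_apply]⟩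

theorem exists_gt_measure_Ioc_eq_zero (hm : IsCountingMeasure m) (τ : ℝ) :
    ∃ s > τ, m (Ioc τ s) = 0 := by
  have := hm.locallyFinite
  obtain ⟨u, hanti, hu, hlim⟩ := exists_seq_strictAnti_tendsto τ
  have hempty : ⋂ n, Ioc τ (u n) = ∅ := eq_empty_of_forall_notMem fun x hx => by
    simp only [mem_iInter, mem_Ioc] at hx
    exact (hx 0).1.not_ge (ge_of_tendsto' hlim fun n => (hx n).2)
  have htend := tendsto_measure_iInter_atTop (μ := m) (s := fun n => Ioc τ (u n))
    (fun _ => measurableSet_Ioc.nullMeasurableSet)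
    (fun _ _ hij => Ioc_subset_Ioc_right (hanti.antitone hij)) ⟨0, measure_Ioc_lt_top.ne⟩
  rw [hempty, measure_empty] at htend
  obtain ⟨n, hn⟩ := (htend.eventually_lt_const one_pos).exists
  exact ⟨u n, hu n, by_contra fun h => hn.not_ge (hm.one_le measurableSet_Ioc h)⟩

theorem exists_first_atom (hm : IsCountingMeasure m) {a b : ℝ} (h : m (Ioc a b) ≠ 0) :
    ∃ τ ∈ Ioc a b, m {τ} ≠ 0 ∧ m (Ioo a τ) = 0 := by
  let S : Set ℝ := {s | m (Ioc a s) ≠ 0}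
  have hlt : ∀ s ∈ S, a < s := fun s hs => by
    by_contra hle
    exact hs (by rw [Ioc_eq_empty hle, measure_empty])
  have hbdd : BddBelow S := ⟨a, fun s hs => (hlt s hs).le⟩
  have hopen : m (Ioo a (sInf S)) = 0 := by
    have hsub : Ioo a (sInf S) ⊆ ⋃ q : {q : ℚ // (q : ℝ) < sInf S}, Ioc a (q : ℝ) := fun x hx => by
      obtain ⟨q, hxq, hq⟩ := exists_rat_btwn hx.2
      exact mem_iUnion.2 ⟨⟨q, hq⟩, hx.1, hxq.le⟩
    exact measure_mono_null hsub
      (measure_iUnion_null fun q => not_not.1 (notMem_of_lt_csInf q.2 hbdd))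
  have hclosed : m (Ioc a (sInf S)) ≠ 0 := fun h0 => by
    obtain ⟨s, hs, hnull⟩ := hm.exists_gt_measure_Ioc_eq_zero (sInf S)
    obtain ⟨s', hs'S, hs's⟩ := exists_lt_of_csInf_lt ⟨b, h⟩ hs
    refine hs'S (measure_mono_null ((Ioc_subset_Ioc_right hs's.le).trans ?_)
      (measure_union_null h0 hnull))
    exact Ioc_subset_Ioc_union_Ioc
  refine ⟨sInf S, ⟨hlt _ hclosed, csInf_le hbdd h⟩, fun hatom => hclosed ?_, hopen⟩
  rw [← Ioo_union_right (hlt _ hclosed)]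
  exact measure_union_null hopen hatom

theorem exists_atom_mem (hm : IsCountingMeasure m) {B : Set ℝ} (hB : MeasurableSet B)
    (h : m B ≠ 0) : ∃ τ ∈ B, m {τ} ≠ 0 := by
  have hcharge : ∃ n : ℤ, m.restrict B (Ioc (n : ℝ) (n + 1)) ≠ 0 := by
    by_contra! hnull
    have := measure_iUnion_null hnull
    rw [iUnion_Ioc_intCast, Measure.restrict_apply_univ] at this
    exact h this
  obtain ⟨n, hn⟩ := hcharge
  obtain ⟨τ, -, hτ, -⟩ := (hm.restrict hB).exists_first_atom hn
  rw [Measure.restrict_apply (measurableSet_singleton τ)] at hτ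
  obtain ⟨_, rfl, hτB⟩ := nonempty_of_measure_ne_zero hτ
  exact ⟨_, hτB, fun h0 => hτ (measure_mono_null inter_subset_left h0)⟩

end IsCountingMeasure

variable {Ω : Type*} {d : ℕ}

section NoPoints

variable {N : Fin d → Ω → Measure ℝ} {A : Set (Fin d)} {I J : Set ℝ} {ω : Ω}

/-- The event that no component in `A` has a point in `I`. -/
def noPoints (N : Fin d → Ω → Measure ℝ) (A : Set (Fin d)) (I : Set ℝ) : Set Ω :=
  {ω | ∀ k ∈ A, N k ω I = 0}

theorem noPoints_anti (hIJ : I ⊆ J) : noPoints N A J ⊆ noPoints N A I :=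
  fun _ h k hk => measure_mono_null hIJ (h k hk)

theorem noPoints_union : noPoints N A (I ∪ J) = noPoints N A I ∩ noPoints N A J := by
  ext ω
  simp only [noPoints, mem_ofPred_eq, measure_union_null_iff, mem_inter_iff, forall_and]

theorem mem_noPoints_univ_iff_sum : ω ∈ noPoints N univ I ↔ (∑ k, N k ω) I = 0 := by
  simp [noPoints, Measure.finsetSum_apply]

theorem mem_noPoints_Ioo_iff {a b : ℝ} :
    ω ∈ noPoints N A (Ioo a b) ↔ ∀ q : ℚ, (q : ℝ) < b → ω ∈ noPoints N A (Ioc a q) := by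
  refine ⟨fun h q hq => noPoints_anti (Ioc_subset_Ioo_right hq) h, fun h k hk => ?_⟩
  have hcover : Ioo a b ⊆ ⋃ q : {q : ℚ // (q : ℝ) < b}, Ioc a (q : ℝ) := fun x hx => by
    obtain ⟨q, hxq, hqb⟩ := exists_rat_btwn hx.2
    exact mem_iUnion.2 ⟨⟨q, hqb⟩, hx.1, hxq.le⟩
  exact measure_mono_null hcover (measure_iUnion_null fun q => h q q.2 k hk)

end NoPoints

section History

variable {N : Fin d → Ω → Measure ℝ} {A B : Set (Fin d)} {k : Fin d} {a s t : ℝ} {J : Set ℝ}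

theorem measurable_restrict_history (hk : k ∈ A) (hJ : MeasurableSet J) (hJt : J ⊆ Iic t) :
    Measurable[history N A t] fun ω => (N k ω).restrict J := by
  have hcomap : Measurable[history N A t] fun ω => (N k ω).restrict (Iic t) :=
    (comap_measurable _).mono (le_iSup₂_of_le k hk le_rfl) le_rfl
  simpa only [Function.comp_def, Measure.restrict_restrict_of_subset hJt] using
    (measurable_restrict_measure hJ).comp hcomap

theorem measurable_apply_history (hk : k ∈ A) (hJ : MeasurableSet J) (hJt : J ⊆ Iic t) :
    Measurable[history N A t] fun ω => N k ω J := by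
  simpa only [Function.comp_def, Measure.restrict_apply_self] using
    (Measure.measurable_coe hJ).comp (measurable_restrict_history hk hJ hJt)

theorem measurableSet_noPoints (hJ : MeasurableSet J) (hJt : J ⊆ Iic t) :
    MeasurableSet[history N A t] (noPoints N A J) := by
  simp only [noPoints, ofPred_forall]
  exact .iInter fun k => .iInter fun hk =>
    measurable_apply_history hk hJ hJt (measurableSet_singleton 0)

theorem history_mono_right (hst : s ≤ t) : history N A s ≤ history N A t :=
  iSup₂_le fun _ hk =>
    (measurable_restrict_history hk measurableSet_Iic (Iic_subset_Iic.2 hst)).comap_le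

theorem history_mono_left (hAB : A ⊆ B) : history N A t ≤ history N B t :=
  biSup_mono hAB

theorem history_le [m : MeasurableSpace Ω] (hN : ∀ k, Measurable (N k)) : history N A t ≤ m :=
  iSup₂_le fun k _ => ((measurable_restrict_measure measurableSet_Iic).comp (hN k)).comap_le

theorem measurable_restrict_historyLeft (hk : k ∈ A) :
    Measurable[historyLeft N A t] fun ω => (N k ω).restrict (Iio t) := by
  refine @Measure.measurable_of_measurable_coe _ _ _ (historyLeft N A t) _ fun T hT => ?_
  obtain ⟨u, hmono, hu, hlim⟩ := exists_seq_strictMono_tendsto t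
  have hsup : ∀ ω, (N k ω).restrict (Iio t) T = ⨆ n, (N k ω).restrict (Iic (u n)) T := fun ω => by
    rw [← iUnion_Iic_eq_Iio_of_lt_of_tendsto hu hlim, Measure.restrict_iUnion_apply_eq_iSup
      (directed_of_isDirected_le fun _ _ h => Iic_subset_Iic.2 (hmono.monotone h)) hT]
  simp only [hsup]
  exact .iSup fun n => (Measure.measurable_coe hT).comp
    ((measurable_restrict_history hk measurableSet_Iic subset_rfl).mono
      (le_iSup₂_of_le (u n) (hu n) le_rfl) le_rfl)

theorem restrict_Iic_eq_of_mem_noPoints {ω : Ω} (hω : ω ∈ noPoints N A (Ioo a t)) (hk : k ∈ A)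
    (hst : s < t) : (N k ω).restrict (Iic s) = (N k ω).restrict (Iic s ∩ Iic a) := by
  refine Measure.restrict_congr_set (Filter.EventuallyLE.antisymm (ae_le_set.2 ?_)
    inter_subset_left.eventuallyLE)
  refine measure_mono_null ?_ (hω k hk)
  rintro x ⟨hxs, hxa⟩
  exact ⟨not_le.1 fun h => hxa ⟨hxs, h⟩, lt_of_le_of_lt hxs hst⟩

theorem comap_historyLeft_le_comap_history (a : ℝ) :
    (historyLeft N A t).comap ((↑) : noPoints N A (Ioo a t) → Ω) ≤
      (history N A a).comap (↑) := by
  rw [MeasurableSpace.comap_le_iff_le_map]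
  refine iSup₂_le fun s hs => iSup₂_le fun k hk => ?_
  rw [← MeasurableSpace.comap_le_iff_le_map, MeasurableSpace.comap_comp,
    ← measurable_iff_comap_le]
  have hfrozen : (fun ω => (N k ω).restrict (Iic s)) ∘ ((↑) : noPoints N A (Ioo a t) → Ω) =
      (fun ω => (N k ω).restrict (Iic s ∩ Iic a)) ∘ (↑) :=
    funext fun ω => restrict_Iic_eq_of_mem_noPoints ω.2 hk hs
  rw [hfrozen]
  exact (measurable_restrict_history hk (measurableSet_Iic.inter measurableSet_Iic)
    inter_subset_right).comp (comap_measurable _)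

theorem exists_measurable_history_eqOn_noPoints {β : Type*} [MeasurableSpace β]
    [StandardBorelSpace β] [Nonempty β] {g : Ω → β} (hg : Measurable[historyLeft N A t] g)
    (a : ℝ) :
    ∃ h : Ω → β, Measurable[history N A a] h ∧ EqOn g h (noPoints N A (Ioo a t)) := by
  obtain ⟨h, hh, hgh⟩ := Measurable.exists_eq_measurable_comp (mY := history N A a)
    ((hg.comp (comap_measurable ((↑) : noPoints N A (Ioo a t) → Ω))).mono
      (comap_historyLeft_le_comap_history a) le_rfl)
  exact ⟨h, hh, fun ω hω => congrFun hgh ⟨ω, hω⟩⟩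

end History

section Predictable

variable {F : ℝ → MeasurableSpace Ω}

theorem predictable_le [m : MeasurableSpace Ω] (hF : ∀ t, F t ≤ m) :
    predictable F ≤ Prod.instMeasurableSpace :=
  MeasurableSpace.generateFrom_le <| by
    rintro _ ⟨s, B, hB, rfl⟩
    exact measurableSet_Ioi.prod (hF s B hB)

theorem measurableSet_predictable_Ioi_prod {s : ℝ} {B : Set Ω} (hB : MeasurableSet[F s] B) :
    MeasurableSet[predictable F] (Ioi s ×ˢ B) :=
  MeasurableSpace.measurableSet_generateFrom ⟨s, B, hB, rfl⟩

theorem measurable_predictable_fst : Measurable[predictable F] (Prod.fst : ℝ × Ω → ℝ) := by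
  refine @measurable_of_Ioi _ _ _ _ _ (predictable F) _ _ _ _ fun s => ?_
  simpa only [prod_univ] using measurableSet_predictable_Ioi_prod (@MeasurableSet.univ _ (F s))

end Predictable

section UntilFirstJump

variable {N : Fin d → Ω → Measure ℝ} {a : ℝ}

/-- The random interval `(a, τ]`, where `τ` is the first time after `a` at which some component
jumps. -/
def untilFirstJump (N : Fin d → Ω → Measure ℝ) (a : ℝ) (ω : Ω) : Set ℝ :=
  {s | a < s ∧ ω ∈ noPoints N univ (Ioo a s)}

theorem Ioc_subset_untilFirstJump {b : ℝ} {ω : Ω} (h : ω ∈ noPoints N univ (Ioo a b)) :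
    Ioc a b ⊆ untilFirstJump N a ω :=
  fun _ hs => ⟨hs.1, noPoints_anti (Ioo_subset_Ioo_right hs.2) h⟩

theorem measurableSet_untilFirstJump (ω : Ω) : MeasurableSet (untilFirstJump N a ω) :=
  OrdConnected.measurableSet
    ⟨fun _ hs _ hs' _ hx => ⟨hs.1.trans_le hx.1, noPoints_anti (Ioo_subset_Ioo_right hx.2) hs'.2⟩⟩

theorem measurableSet_predictable_untilFirstJump :
    MeasurableSet[predictable (history N univ)] {p : ℝ × Ω | p.1 ∈ untilFirstJump N a p.2} := by
  have hrat : {p : ℝ × Ω | p.1 ∈ untilFirstJump N a p.2} =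
      Ioi a ×ˢ univ \ ⋃ q : ℚ, Ioi (q : ℝ) ×ˢ (noPoints N univ (Ioc a q))ᶜ := by
    ext ⟨s, ω⟩
    simp [untilFirstJump, mem_noPoints_Ioo_iff]
  rw [hrat]
  exact (measurableSet_predictable_Ioi_prod .univ).diff (.iUnion fun q =>
    measurableSet_predictable_Ioi_prod
      (measurableSet_noPoints measurableSet_Ioc Ioc_subset_Iic_self).compl)

theorem one_le_sum_apply_untilFirstJump {b : ℝ} {ω : Ω} (hN : ∀ i, IsCountingMeasure (N i ω))
    (hjump : ω ∉ noPoints N univ (Ioc a b)) :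
    1 ≤ ∑ i, N i ω (Ioc a b ∩ untilFirstJump N a ω) := by
  have hsum := IsCountingMeasure.sum hN
  obtain ⟨τ, hτ, hatom, hquiet⟩ :=
    hsum.exists_first_atom (mt mem_noPoints_univ_iff_sum.2 hjump)
  have hmem : τ ∈ Ioc a b ∩ untilFirstJump N a ω :=
    ⟨hτ, hτ.1, mem_noPoints_univ_iff_sum.2 hquiet⟩
  rw [← Measure.finsetSum_apply]
  exact (hsum.one_le (measurableSet_singleton τ) hatom).trans
    (measure_mono (singleton_subset_iff.2 hmem))

end UntilFirstJump

section ConditionalIntensity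

variable [MeasurableSpace Ω] {P : Measure Ω} {N : Fin d → Ω → Measure ℝ} {i : Fin d}
  {lam : ℝ → Ω → ℝ≥0∞} {a : ℝ} {U : Set ℝ} {B : Set Ω}

theorem measurable_apply_untilFirstJump (hN : IsPointProcess N) (hU : MeasurableSet U) :
    Measurable fun ω => N i ω (U ∩ untilFirstJump N a ω) := by
  have hS : MeasurableSet {p : Ω × ℝ | p.2 ∈ U ∩ untilFirstJump N a p.1} :=
    (measurable_snd hU).inter (measurable_swap <|
      predictable_le (fun _ => history_le hN.measurable) _ measurableSet_predictable_untilFirstJump)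
  exact measurable_apply_prodMk_preimage (hN.measurable i)
    (fun ω => (hN.counting i ω).locallyFinite) hS

namespace IsConditionalIntensity

theorem lintegral_section_eq (hN : ∀ k, Measurable (N k)) (h : IsConditionalIntensity P N i lam)
    {S : Set (ℝ × Ω)} (hS : MeasurableSet[predictable (history N univ)] S) :
    ∫⁻ ω, (∫⁻ t in {t | (t, ω) ∈ S}, lam t ω) ∂P = ∫⁻ ω, N i ω {t | (t, ω) ∈ S} ∂P := by
  have hsection : ∀ ω, MeasurableSet {t | (t, ω) ∈ S} := fun ω =>
    measurable_prodMk_right (predictable_le (fun _ => history_le hN) _ hS)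
  have hindicator : Measurable[predictable (history N univ)]
      fun p : ℝ × Ω => {t | (t, p.2) ∈ S}.indicator (1 : ℝ → ℝ≥0∞) p.1 :=
    letI := predictable (history N univ)
    measurable_one.indicator hS
  have hmul : ∀ ω t, {t | (t, ω) ∈ S}.indicator 1 t * lam t ω =
      {t | (t, ω) ∈ S}.indicator (fun t => lam t ω) t := fun ω t => by
    by_cases ht : (t, ω) ∈ S <;> simp [ht]
  simpa only [hmul, lintegral_indicator_one (hsection _), lintegral_indicator (hsection _)] using
    h.lintegral_eq (fun t ω => {t | (t, ω) ∈ S}.indicator 1 t) hindicator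

theorem setLIntegral_untilFirstJump (hN : ∀ k, Measurable (N k))
    (h : IsConditionalIntensity P N i lam) (hB : MeasurableSet[history N univ a] B)
    (hU : MeasurableSet U) :
    ∫⁻ ω in B, (∫⁻ s in U ∩ untilFirstJump N a ω, lam s ω) ∂P =
      ∫⁻ ω in B, N i ω (U ∩ untilFirstJump N a ω) ∂P := by
  have hB' : MeasurableSet B := history_le hN B hB
  let S : Set (ℝ × Ω) := {p | p.2 ∈ B ∧ p.1 ∈ U ∩ untilFirstJump N a p.2}
  have hS : MeasurableSet[predictable (history N univ)] S := by
    have hS_eq : S = Prod.fst ⁻¹' U ∩ {p | p.1 ∈ untilFirstJump N a p.2} ∩ Ioi a ×ˢ B := by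
      ext ⟨s, ω⟩
      simp only [S, untilFirstJump, mem_inter_iff, mem_preimage, mem_prod, mem_ofPred_eq, mem_Ioi]
      tauto
    rw [hS_eq]
    exact ((measurable_predictable_fst hU).inter measurableSet_predictable_untilFirstJump).inter
      (measurableSet_predictable_Ioi_prod hB)
  rw [← lintegral_indicator hB', ← lintegral_indicator hB']
  convert h.lintegral_section_eq hN hS using 3 with ω ω <;>
    by_cases hω : ω ∈ B <;> simp [S, hω]

theorem ae_ae_lt_top [SFinite P] (hN : ∀ k, Measurable (N k))
    (h : IsConditionalIntensity P N i lam) : ∀ᵐ t, ∀ᵐ ω ∂P, lam t ω < ∞ := by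
  have hlam : Measurable fun p : ℝ × Ω => lam p.1 p.2 :=
    h.measurable_predictable.mono (predictable_le fun _ => history_le hN) le_rfl
  refine (Measure.ae_ae_comm (p := fun ω t => lam t ω < ∞)
    ((hlam.comp measurable_swap) measurableSet_Iio)).1 ?_
  filter_upwards [h.locallyIntegrable] with ω hω
  rw [← Measure.restrict_univ (μ := volume), ← iUnion_Ioc_intCast, ae_restrict_iUnion_iff]
  exact fun n => ae_lt_top (hlam.comp measurable_prodMk_right)
    ((lintegral_mono_set Ioc_subset_Icc_self).trans_lt (hω n (n + 1))).ne

theorem ae_apply_eq_zero (hN : ∀ k, Measurable (N k)) (h : IsConditionalIntensity P N i lam)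
    (hU : MeasurableSet U) (hnull : volume U = 0) : ∀ᵐ ω ∂P, N i ω U = 0 := by
  refine (lintegral_eq_zero_iff ((Measure.measurable_coe hU).comp (hN i))).1 ?_
  refine (h.lintegral_section_eq hN (measurable_predictable_fst hU)).symm.trans ?_
  exact lintegral_eq_zero_of_ae_eq_zero (.of_forall fun ω => setLIntegral_measure_zero U _ hnull)

end IsConditionalIntensity

theorem measure_diff_noPoints_le {lam : Fin d → ℝ → Ω → ℝ≥0∞} {b : ℝ} (hN : IsPointProcess N)
    (h : ∀ i, IsConditionalIntensity P N i (lam i)) (hB : MeasurableSet[history N univ a] B) :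
    P (B \ noPoints N univ (Ioc a b)) ≤
      ∑ i, ∫⁻ ω in B, (∫⁻ s in Ioc a b ∩ untilFirstJump N a ω, lam i s ω) ∂P := by
  have hjump : MeasurableSet (noPoints N univ (Ioc a b))ᶜ :=
    (history_le hN.measurable _ (measurableSet_noPoints measurableSet_Ioc
      Ioc_subset_Iic_self)).compl
  calc P (B \ noPoints N univ (Ioc a b))
      = ∫⁻ ω in B, (noPoints N univ (Ioc a b))ᶜ.indicator 1 ω ∂P := by
        rw [lintegral_indicator_one hjump, Measure.restrict_apply hjump, inter_comm, sdiff_eq]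
    _ ≤ ∫⁻ ω in B, ∑ i, N i ω (Ioc a b ∩ untilFirstJump N a ω) ∂P :=
        lintegral_mono fun ω => indicator_le' (fun ω hω => one_le_sum_apply_untilFirstJump
          (fun i => hN.counting i ω) hω) (fun _ _ => zero_le) ω
    _ = ∑ i, ∫⁻ ω in B, (∫⁻ s in Ioc a b ∩ untilFirstJump N a ω, lam i s ω) ∂P := by
        rw [lintegral_finsetSum _ fun i _ => measurable_apply_untilFirstJump hN measurableSet_Ioc]
        exact Finset.sum_congr rfl fun i _ =>
          ((h i).setLIntegral_untilFirstJump hN.measurable hB measurableSet_Ioc).symm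

end ConditionalIntensity

section IntensityOn

variable {N : Fin d → Ω → Measure ℝ} {ν : Fin d → ℝ} {φ : Fin d → Fin d → ℝ → ℝ} {i : Fin d}
  {I J : Set ℝ} {a r s t : ℝ} {ω : Ω}

/-- The intensity at time `t` produced by the points in `I` alone. `I = Iio t` gives the intensity
itself, `I = Iic a` the intensity frozen at time `a`. -/
noncomputable def intensityOn (N : Fin d → Ω → Measure ℝ) (ν : Fin d → ℝ)
    (φ : Fin d → Fin d → ℝ → ℝ) (I : Set ℝ) (i : Fin d) (t : ℝ) (ω : Ω) : ℝ≥0∞ :=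
  ENNReal.ofReal (ν i) + ∑ j, ∫⁻ u in I, ENNReal.ofReal (φ i j (t - u)) ∂(N j ω)

theorem intensityOn_mono (hIJ : I ⊆ J) : intensityOn N ν φ I i t ω ≤ intensityOn N ν φ J i t ω :=
  add_le_add_right (Finset.sum_le_sum fun _ _ => lintegral_mono_set hIJ) _

theorem intensityOn_union (hJ : MeasurableSet J) (hIJ : Disjoint I J) :
    intensityOn N ν φ (I ∪ J) i t ω = intensityOn N ν φ I i t ω +
      ∑ j, ∫⁻ u in J, ENNReal.ofReal (φ i j (t - u)) ∂(N j ω) := by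
  simp only [intensityOn, lintegral_union hJ hIJ, Finset.sum_add_distrib, add_assoc]

theorem intensityOn_union_of_noPoints (h : ω ∈ noPoints N univ J) :
    intensityOn N ν φ (I ∪ J) i t ω = intensityOn N ν φ I i t ω := by
  have hrestrict : ∀ j, (N j ω).restrict (I ∪ J) = (N j ω).restrict I := fun j =>
    Measure.restrict_congr_set
      (union_ae_eq_left_of_ae_eq_empty (ae_eq_empty.2 (h j (mem_univ j))))
  simp only [intensityOn, hrestrict]

theorem intensity_eq_intensityOn_Iic (has : a < s) (h : ω ∈ noPoints N univ (Ioo a s)) :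
    intensity N ν φ i s ω = intensityOn N ν φ (Iic a) i s ω := by
  rw [← intensityOn_union_of_noPoints h, Iic_union_Ioo_eq_Iio has]
  rfl

theorem intensityOn_Iic_eq (har : a ≤ r) (h : ω ∈ noPoints N univ (Ioc a r)) :
    intensityOn N ν φ (Iic r) i t ω = intensityOn N ν φ (Iic a) i t ω := by
  rw [← Iic_union_Ioc_eq_Iic har, intensityOn_union_of_noPoints h]

theorem measurable_intensityOn [MeasurableSpace Ω]
    (hN : ∀ j, Measurable fun ω => (N j ω).restrict I)
    (hfin : ∀ j ω, IsLocallyFiniteMeasure (N j ω)) (hφ : ∀ j, Measurable (φ i j)) :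
    Measurable fun p : ℝ × Ω => intensityOn N ν φ I i p.1 p.2 := by
  refine Measurable.const_add (f := fun p : ℝ × Ω =>
    ∑ j, ∫⁻ u in I, ENNReal.ofReal (φ i j (p.1 - u)) ∂(N j p.2)) ?_ _
  refine Finset.measurable_sum _ fun j _ => ?_
  refine measurable_lintegral_of_locallyFinite ((hN j).comp measurable_snd)
    (fun p => have := hfin j p.2
      inferInstanceAs (IsLocallyFiniteMeasure ((N j p.2).restrict I))) ?_
  have := hφ j
  unfold Function.uncurry
  fun_prop

theorem measurable_history_intensityOn_Iic (hfin : ∀ j ω, IsLocallyFiniteMeasure (N j ω))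
    (hφ : ∀ j, Measurable (φ i j)) :
    Measurable[Prod.instMeasurableSpace (m₂ := history N univ a)]
      fun p : ℝ × Ω => intensityOn N ν φ (Iic a) i p.1 p.2 :=
  let _ := history N univ a
  measurable_intensityOn
    (fun j => measurable_restrict_history (mem_univ j) measurableSet_Iic subset_rfl) hfin hφ

theorem measurableSet_history_forall_setLIntegral_intensityOn_le
    (hfin : ∀ j ω, IsLocallyFiniteMeasure (N j ω)) (hφ : ∀ i j, Measurable (φ i j)) (r : ℕ → ℝ)
    (n : ℕ) (ε : ℝ≥0∞) :
    MeasurableSet[history N univ a] {ω | ∀ k < n, ∀ i,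
      ∫⁻ s in Ioc (r k) (r (k + 1)), intensityOn N ν φ (Iic a) i s ω ≤ ε} := by
  let _ := history N univ a
  simp only [ofPred_forall]
  exact .iInter fun k => .iInter fun _ => .iInter fun i =>
    (measurable_history_intensityOn_Iic hfin (hφ i)).lintegral_prod_left' measurableSet_Iic

end IntensityOn

theorem eventually_forall_setLIntegral_Ioc_lt {f : ℝ → ℝ≥0∞} {S : Set ℝ}
    (hf : ∫⁻ s in S, f s ≠ ∞) {ε : ℝ≥0∞} (hε : ε ≠ 0) :
    ∀ᶠ δ in nhds 0, ∀ c, Ioc c (c + δ) ⊆ S → ∫⁻ s in Ioc c (c + δ), f s < ε := by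
  obtain ⟨η, hη, hsmall⟩ := exists_pos_setLIntegral_lt_of_measure_lt hf hε
  have hlim : Filter.Tendsto ENNReal.ofReal (nhds 0) (nhds 0) := by
    simpa using ENNReal.continuous_ofReal.tendsto 0
  filter_upwards [hlim.eventually_lt_const hη] with δ hδ c hc
  have hvolume : volume.restrict S (Ioc c (c + δ)) < η := by
    refine (Measure.restrict_apply_le _ _).trans_lt ?_
    rwa [Real.volume_Ioc, add_sub_cancel_left]
  simpa only [Measure.restrict_restrict_of_subset hc] using hsmall _ hvolume

section GridPoint

/-- The `k`-th point of the grid of step `1 / (n + 1)` started at `a`, along which a time interval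
is cut into short pieces. -/
noncomputable def gridPoint (a : ℝ) (n k : ℕ) : ℝ :=
  a + k * (1 / ((n : ℝ) + 1))

theorem gridPoint_zero (a : ℝ) (n : ℕ) : gridPoint a n 0 = a := by
  simp [gridPoint]

theorem gridPoint_succ (a : ℝ) (n k : ℕ) :
    gridPoint a n (k + 1) = gridPoint a n k + 1 / ((n : ℝ) + 1) := by
  rw [gridPoint, gridPoint, Nat.cast_succ, add_one_mul, add_assoc]

theorem gridPoint_mul_succ (a : ℝ) (n l : ℕ) : gridPoint a n (l * (n + 1)) = a + l := by
  rw [gridPoint]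
  push_cast
  field_simp

theorem monotone_gridPoint (a : ℝ) (n : ℕ) : Monotone (gridPoint a n) :=
  monotone_nat_of_le_succ fun k => by
    rw [gridPoint_succ, le_add_iff_nonneg_right]
    positivity

end GridPoint

section Quiet

variable [MeasurableSpace Ω] {P : Measure Ω} {N : Fin d → Ω → Measure ℝ}
  {ν : Fin d → ℝ} {φ : Fin d → Fin d → ℝ → ℝ} {a t : ℝ} {A B : Set Ω} {ε : ℝ≥0∞}

theorem measure_diff_noPoints_le_lintegral_intensityOn (hN : IsPointProcess N)
    (hlam : ∀ i, IsConditionalIntensity P N i (intensity N ν φ i))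
    (hB : MeasurableSet[history N univ a] B) :
    P (B \ noPoints N univ (Ioc a t)) ≤
      ∑ i, ∫⁻ ω in B, (∫⁻ s in Ioc a t, intensityOn N ν φ (Iic a) i s ω) ∂P := by
  refine (measure_diff_noPoints_le hN hlam hB).trans ?_
  refine Finset.sum_le_sum fun i _ => lintegral_mono fun ω => ?_
  calc ∫⁻ s in Ioc a t ∩ untilFirstJump N a ω, intensity N ν φ i s ω
      = ∫⁻ s in Ioc a t ∩ untilFirstJump N a ω, intensityOn N ν φ (Iic a) i s ω :=
        setLIntegral_congr_fun (measurableSet_Ioc.inter (measurableSet_untilFirstJump ω))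
          fun s hs => intensity_eq_intensityOn_Iic hs.2.1 hs.2.2
    _ ≤ _ := lintegral_mono_set inter_subset_left

theorem ae_eventually_setLIntegral_intensityOn_lt
    (hlam : ∀ i, IsConditionalIntensity P N i (intensity N ν φ i)) (a b : ℝ) (hε : ε ≠ 0) :
    ∀ᵐ ω ∂P, ∀ᶠ δ in nhds 0, ∀ i c, Ioc c (c + δ) ⊆ Ioc a b →
      ∫⁻ s in Ioc c (c + δ), intensityOn N ν φ (Iic a) i s ω < ε := by
  filter_upwards [ae_all_iff.2 fun i => (hlam i).locallyIntegrable] with ω hω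
  refine Filter.eventually_all.2 fun i => eventually_forall_setLIntegral_Ioc_lt (ne_of_lt ?_) hε
  calc ∫⁻ s in Ioc a b, intensityOn N ν φ (Iic a) i s ω
      ≤ ∫⁻ s in Ioc a b, intensity N ν φ i s ω :=
        setLIntegral_mono' measurableSet_Ioc fun s hs => intensityOn_mono (Iic_subset_Iio.2 hs.1)
    _ ≤ ∫⁻ s in Icc a b, intensity N ν φ i s ω := lintegral_mono_set Ioc_subset_Icc_self
    _ < ∞ := hω i a b

theorem ae_exists_forall_setLIntegral_intensityOn_le
    (hlam : ∀ i, IsConditionalIntensity P N i (intensity N ν φ i)) (a : ℝ) (l : ℕ) (hε : ε ≠ 0) :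
    ∀ᵐ ω ∂P, ∃ n, ∀ k < l * (n + 1), ∀ i,
      ∫⁻ s in Ioc (gridPoint a n k) (gridPoint a n (k + 1)),
        intensityOn N ν φ (Iic a) i s ω ≤ ε := by
  filter_upwards [ae_eventually_setLIntegral_intensityOn_lt hlam a (a + l) hε] with ω hω
  obtain ⟨n, hn⟩ := (tendsto_one_div_add_atTop_nhds_zero_nat.eventually hω).exists
  refine ⟨n, fun k hk i => ?_⟩
  have hsub : Ioc (gridPoint a n k) (gridPoint a n (k + 1)) ⊆ Ioc a (a + l) :=
    Ioc_subset_Ioc ((gridPoint_zero a n).ge.trans (monotone_gridPoint a n k.zero_le))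
      ((monotone_gridPoint a n hk).trans (gridPoint_mul_succ a n l).le)
  rw [gridPoint_succ] at hsub ⊢
  exact (hn i _ hsub).le

variable [IsFiniteMeasure P]

theorem measure_eq_zero_of_setLIntegral_intensityOn_le (hN : IsPointProcess N)
    (hlam : ∀ i, IsConditionalIntensity P N i (intensity N ν φ i)) (hε : d * ε < 1)
    (hB : MeasurableSet[history N univ a] B)
    (hsmall : ∀ ω ∈ B, ∀ i, ∫⁻ s in Ioc a t, intensityOn N ν φ (Iic a) i s ω ≤ ε)
    (hnull : P (B ∩ noPoints N univ (Ioc a t)) = 0) : P B = 0 := by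
  have hle : P B ≤ d * ε * P B :=
    calc P B ≤ P (B ∩ noPoints N univ (Ioc a t)) + P (B \ noPoints N univ (Ioc a t)) :=
          measure_le_inter_add_sdiff P B _
      _ ≤ ∑ _i : Fin d, ∫⁻ _ω in B, ε ∂P := by
          rw [hnull, zero_add]
          exact (measure_diff_noPoints_le_lintegral_intensityOn hN hlam hB).trans
            (Finset.sum_le_sum fun i _ => setLIntegral_mono' (history_le hN.measurable B hB)
              (hsmall · · i))
      _ = d * ε * P B := by simp [mul_assoc]
  by_contra hpos
  refine hle.not_gt ?_
  simpa only [one_mul] using (ENNReal.mul_lt_mul_iff_left hpos (measure_ne_top P B)).2 hε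

theorem measure_eq_zero_of_forall_setLIntegral_intensityOn_le (hN : IsPointProcess N)
    (hlam : ∀ i, IsConditionalIntensity P N i (intensity N ν φ i)) (hε : d * ε < 1)
    {r : ℕ → ℝ} (hr : Monotone r) (hB : MeasurableSet[history N univ (r 0)] B) {n : ℕ}
    (hsmall : ∀ k < n, ∀ ω ∈ B, ∀ i,
      ∫⁻ s in Ioc (r k) (r (k + 1)), intensityOn N ν φ (Iic (r 0)) i s ω ≤ ε)
    (hnull : P (B ∩ noPoints N univ (Ioc (r 0) (r n))) = 0) : P B = 0 := by
  induction n with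
  | zero => simpa [noPoints] using hnull
  | succ n ih =>
    refine ih (fun k hk => hsmall k (hk.trans n.lt_succ_self)) ?_
    have h0n : r 0 ≤ r n := hr n.zero_le
    refine measure_eq_zero_of_setLIntegral_intensityOn_le (t := r (n + 1)) hN hlam hε
      ((history_mono_right h0n _ hB).inter
        (measurableSet_noPoints measurableSet_Ioc Ioc_subset_Iic_self)) ?_ ?_
    · rintro ω ⟨hωB, hquiet⟩ i
      simpa only [intensityOn_Iic_eq h0n hquiet] using hsmall n n.lt_succ_self ω hωB i
    · rwa [inter_assoc, ← noPoints_union, Ioc_union_Ioc_eq_Ioc h0n (hr n.le_succ)]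

theorem measure_inter_noPoints_Ioc_eq_zero_iff (hN : IsPointProcess N)
    (hφ : ∀ i j, Measurable (φ i j))
    (hlam : ∀ i, IsConditionalIntensity P N i (intensity N ν φ i))
    (hA : MeasurableSet[history N univ a] A) :
    P (A ∩ noPoints N univ (Ioc a t)) = 0 ↔ P A = 0 := by
  refine ⟨fun hnull => ?_, measure_mono_null inter_subset_left⟩
  obtain ⟨ε, hε0, hε⟩ :=
    ENNReal.exists_nnreal_pos_mul_lt (ENNReal.natCast_ne_top d) one_ne_zero
  obtain ⟨l, hl⟩ := exists_nat_ge (t - a)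
  let C : ℕ → Set Ω := fun n => {ω | ∀ k < l * (n + 1), ∀ i,
    ∫⁻ s in Ioc (gridPoint a n k) (gridPoint a n (k + 1)), intensityOn N ν φ (Iic a) i s ω ≤ ε}
  have hC : ∀ n, MeasurableSet[history N univ a] (C n) := fun n =>
    measurableSet_history_forall_setLIntegral_intensityOn_le
      (fun j ω => (hN.counting j ω).locallyFinite) hφ (gridPoint a n) (l * (n + 1)) ε
  have hAC : ∀ n, P (A ∩ C n) = 0 := fun n => by
    refine measure_eq_zero_of_forall_setLIntegral_intensityOn_le (n := l * (n + 1)) hN hlam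
      (mul_comm (ε : ℝ≥0∞) d ▸ hε) (monotone_gridPoint a n) ?_ ?_ ?_ <;> rw [gridPoint_zero]
    · exact hA.inter (hC n)
    · exact fun k hk ω hω => hω.2 k hk
    · rw [gridPoint_mul_succ]
      exact measure_mono_null (inter_subset_inter inter_subset_left
        (noPoints_anti (Ioc_subset_Ioc_right (by linarith)))) hnull
  refine measure_eq_zero_iff_ae_notMem.2 ?_
  filter_upwards [ae_exists_forall_setLIntegral_intensityOn_le hlam a l
    (ENNReal.coe_ne_zero.2 hε0.ne'), ae_all_iff.2 fun n => measure_eq_zero_iff_ae_notMem.1 (hAC n)]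
    with ω ⟨n, hn⟩ hω hωA using hω n ⟨hωA, hn⟩

end Quiet

theorem eq_zero_of_sum_le_one {ι : Type*} [Fintype ι] {f : ι → ℝ≥0∞} (hf : ∑ l, f l ≤ 1) {i k : ι}
    (hi : 1 ≤ f i) (hki : k ≠ i) : f k = 0 := by
  classical
  have hpair : 1 + f k ≤ 1 + 0 :=
    calc 1 + f k ≤ f i + f k := add_le_add_left hi _
      _ = ∑ l ∈ {i, k}, f l := (Finset.sum_pair hki.symm).symm
      _ ≤ ∑ l, f l := Finset.sum_le_univ_sum_of_nonneg fun _ => zero_le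
      _ ≤ 1 + 0 := by rwa [add_zero]
  exact nonpos_iff_eq_zero.1 ((ENNReal.add_le_add_iff_left ENNReal.one_ne_top).1 hpair)

section SingleComponentJump

variable {N : Fin d → Ω → Measure ℝ} {ν : Fin d → ℝ} {φ : Fin d → Fin d → ℝ → ℝ} {i : Fin d}
  {a t : ℝ} {U : Set ℝ} {ω : Ω}

theorem exists_rat_mem_noPoints_compl (hN : ∀ k, IsCountingMeasure (N k ω))
    (hsimple : ∀ τ, ∑ k, N k ω {τ} ≤ 1) (hU : MeasurableSet U)
    (hjump : N i ω (U ∩ untilFirstJump N a ω) ≠ 0) :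
    ∃ q : ℚ, N i ω (U ∩ Iic (q : ℝ)) ≠ 0 ∧ ω ∈ noPoints N {i}ᶜ (Ioc a q) := by
  obtain ⟨τ, ⟨hτU, haτ, hbefore⟩, hatom⟩ :=
    (hN i).exists_atom_mem (hU.inter (measurableSet_untilFirstJump ω)) hjump
  obtain ⟨s, hτs, hafter⟩ :=
    (IsCountingMeasure.sum hN).exists_gt_measure_Ioc_eq_zero τ
  obtain ⟨q, hτq, hq⟩ := exists_rat_btwn hτs
  have hat : ω ∈ noPoints N {i}ᶜ {τ} := fun k hk =>
    eq_zero_of_sum_le_one (hsimple τ) ((hN i).one_le (measurableSet_singleton τ) hatom) hk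
  have hsub : {τ} ⊆ U ∩ Iic (q : ℝ) := singleton_subset_iff.2 ⟨hτU, hτq.le⟩
  refine ⟨q, mt (measure_mono_null hsub) hatom, ?_⟩
  rw [← Ioc_union_Ioc_eq_Ioc haτ.le hτq.le, ← Ioo_union_right haτ, noPoints_union,
    noPoints_union]
  refine ⟨⟨fun k _ => hbefore k (mem_univ k), hat⟩, fun k _ => ?_⟩
  exact measure_mono_null (Ioc_subset_Ioc_right hq.le)
    (mem_noPoints_univ_iff_sum.2 hafter k (mem_univ k))

variable [MeasurableSpace Ω] {P : Measure Ω} [IsFiniteMeasure P] [NeZero P]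

theorem measure_apply_untilFirstJump_ne_zero (hN : IsPointProcess N)
    (hφ : ∀ i j, Measurable (φ i j))
    (hlam : ∀ i, IsConditionalIntensity P N i (intensity N ν φ i)) (hν : 0 < ν i)
    (hU : MeasurableSet U) (hUat : U ⊆ Ioo a t) (hUpos : volume U ≠ 0) :
    P {ω | N i ω (U ∩ untilFirstJump N a ω) ≠ 0} ≠ 0 := by
  intro hnull
  have hquiet : MeasurableSet (noPoints N univ (Ioc a t)) :=
    history_le hN.measurable _ (measurableSet_noPoints measurableSet_Ioc Ioc_subset_Iic_self)
  have hbound : ENNReal.ofReal (ν i) * volume U * P (noPoints N univ (Ioc a t)) ≤ 0 :=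
    calc ENNReal.ofReal (ν i) * volume U * P (noPoints N univ (Ioc a t))
        = ∫⁻ _ω in noPoints N univ (Ioc a t), (∫⁻ _s in U, ENNReal.ofReal (ν i)) ∂P := by simp
      _ ≤ ∫⁻ ω in noPoints N univ (Ioc a t),
            (∫⁻ s in U ∩ untilFirstJump N a ω, intensity N ν φ i s ω) ∂P := by
          refine setLIntegral_mono' hquiet fun ω hω => ?_
          rw [inter_eq_left.2 ((hUat.trans Ioo_subset_Ioc_self).trans
            (Ioc_subset_untilFirstJump (noPoints_anti Ioo_subset_Ioc_self hω)))]
          exact lintegral_mono fun s => le_self_add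
      _ ≤ ∫⁻ ω, (∫⁻ s in U ∩ untilFirstJump N a ω, intensity N ν φ i s ω) ∂P :=
          setLIntegral_le_lintegral _ _
      _ = ∫⁻ ω, N i ω (U ∩ untilFirstJump N a ω) ∂P := by
          simpa only [Measure.restrict_univ] using
            (hlam i).setLIntegral_untilFirstJump hN.measurable (a := a) .univ hU
      _ = 0 := lintegral_eq_zero_of_ae_eq_zero hnull
  have hquiet_null : P (noPoints N univ (Ioc a t)) = 0 := by
    simpa [hν.not_ge, hUpos] using hbound
  refine (Measure.measure_univ_ne_zero.2 (NeZero.ne P)) ?_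
  refine (measure_inter_noPoints_Ioc_eq_zero_iff (a := a) (t := t) hN hφ hlam .univ).1 ?_
  rwa [univ_inter]

theorem measure_apply_inter_noPoints_compl_ne_zero (hN : IsPointProcess N) (hsimple : IsSimple P N)
    (hφ : ∀ i j, Measurable (φ i j))
    (hlam : ∀ i, IsConditionalIntensity P N i (intensity N ν φ i)) (hν : 0 < ν i)
    (hU : MeasurableSet U) (hUat : U ⊆ Ioo a t) (hUpos : volume U ≠ 0) :
    P ({ω | N i ω U ≠ 0} ∩ noPoints N {i}ᶜ (Ioo a t)) ≠ 0 := by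
  intro hnull
  let E : ℝ → Set Ω := fun r => {ω | N i ω (U ∩ Iic r) ≠ 0} ∩ noPoints N {i}ᶜ (Ioc a r)
  have hE : ∀ q : ℚ, P (E q) = 0 := fun q => by
    have hE_meas : MeasurableSet[history N univ q] (E q) :=
      MeasurableSet.inter
        (measurable_apply_history (mem_univ i) (hU.inter measurableSet_Iic) inter_subset_right
          (measurableSet_singleton 0)).compl
        (history_mono_left (subset_univ _) _
          (measurableSet_noPoints measurableSet_Ioc Ioc_subset_Iic_self))
    refine (measure_inter_noPoints_Ioc_eq_zero_iff (t := t) hN hφ hlam hE_meas).1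
      (measure_mono_null ?_ hnull)
    rintro ω ⟨⟨hpos, hbefore⟩, hafter⟩
    refine ⟨fun h => hpos (measure_mono_null inter_subset_left h), fun k hk => ?_⟩
    exact measure_mono_null (Ioo_subset_Ioc_self.trans Ioc_subset_Ioc_union_Ioc)
      (measure_union_null (hbefore k hk) (hafter k (mem_univ k)))
  refine measure_apply_untilFirstJump_ne_zero hN hφ hlam hν hU hUat hUpos ?_
  refine measure_eq_zero_iff_ae_notMem.2 ?_
  filter_upwards [hsimple, ae_all_iff.2 fun q => measure_eq_zero_iff_ae_notMem.1 (hE q)]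
    with ω hω hωE hjump
  obtain ⟨q, hq⟩ := exists_rat_mem_noPoints_compl (fun k => hN.counting k ω) hω hU hjump
  exact hωE q hq

end SingleComponentJump

section LinkSupport

variable [MeasurableSpace Ω] {P : Measure Ω} [IsFiniteMeasure P] {N : Fin d → Ω → Measure ℝ}
  {ν : Fin d → ℝ} {φ : Fin d → Fin d → ℝ → ℝ} {i j : Fin d} {A : Set (Fin d)} {a t : ℝ}

theorem intensityOn_Iic_ae_eq_of_eqOn (hN : IsPointProcess N) (hφ : ∀ i j, Measurable (φ i j))
    (hlam : ∀ i, IsConditionalIntensity P N i (intensity N ν φ i)) (hat : a < t)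
    {g h : Ω → ℝ≥0∞} (hg : intensity N ν φ j t =ᵐ[P] g) (hh : Measurable[history N A a] h)
    (hgh : EqOn g h (noPoints N A (Ioo a t))) : intensityOn N ν φ (Iic a) j t =ᵐ[P] h := by
  have hfrozen : Measurable[history N univ a] (intensityOn N ν φ (Iic a) j t) :=
    (measurable_history_intensityOn_Iic (fun k ω => (hN.counting k ω).locallyFinite) (hφ j)).comp
      (@measurable_prodMk_left _ _ _ (history N univ a) t)
  have hne : MeasurableSet[history N univ a] {ω | intensityOn N ν φ (Iic a) j t ω ≠ h ω} :=
    (measurableSet_eq_fun hfrozen (hh.mono (history_mono_left (subset_univ A)) le_rfl)).compl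
  refine (measure_inter_noPoints_Ioc_eq_zero_iff (t := t) hN hφ hlam hne).1
    (measure_mono_null ?_ hg)
  rintro ω ⟨hω, hquiet⟩ hωg
  have hquiet' : ω ∈ noPoints N univ (Ioo a t) := noPoints_anti Ioo_subset_Ioc_self hquiet
  exact hω (by rw [← intensity_eq_intensityOn_Iic hat hquiet', hωg,
    hgh fun k _ => hquiet' k (mem_univ k)])

theorem ae_setLIntegral_link_eq_zero (hN : IsPointProcess N) (hφ : ∀ i j, Measurable (φ i j))
    (hlam : ∀ i, IsConditionalIntensity P N i (intensity N ν φ i)) (hat : a < t)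
    (hfin : ∀ᵐ ω ∂P, intensity N ν φ j t ω < ∞) {g : Ω → ℝ≥0∞}
    (hg : Measurable[historyLeft N A t] g) (hlg : intensity N ν φ j t =ᵐ[P] g) :
    ∀ᵐ ω ∂P, ω ∈ noPoints N A (Ioo a t) →
      ∀ k, ∫⁻ u in Ioo a t, ENNReal.ofReal (φ j k (t - u)) ∂(N k ω) = 0 := by
  obtain ⟨h, hh, hgh⟩ := exists_measurable_history_eqOn_noPoints hg a
  filter_upwards [hfin, hlg, intensityOn_Iic_ae_eq_of_eqOn hN hφ hlam hat hlg hh hgh]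
    with ω hωfin hωg hωh hω
  have hdisjoint : Disjoint (Iic a) (Ioo a t) :=
    (Iic_disjoint_Ioc le_rfl).mono_right Ioo_subset_Ioc_self
  have hsplit : intensity N ν φ j t ω = intensityOn N ν φ (Iic a) j t ω +
      ∑ k, ∫⁻ u in Ioo a t, ENNReal.ofReal (φ j k (t - u)) ∂(N k ω) := by
    rw [← intensityOn_union measurableSet_Ioo hdisjoint, Iic_union_Ioo_eq_Iio hat]
    rfl
  have hfrozen : intensity N ν φ j t ω = intensityOn N ν φ (Iic a) j t ω := by
    rw [hωg, hgh hω, hωh]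
  have hsum : ∑ k, ∫⁻ u in Ioo a t, ENNReal.ofReal (φ j k (t - u)) ∂(N k ω) = 0 := by
    refine (ENNReal.add_right_inj (hfrozen ▸ hωfin.ne)).1 (hsplit.symm.trans ?_)
    rw [hfrozen, add_zero]
  simpa using hsum

variable [NeZero P]

theorem ae_link_nonpos_of_grangerNoncausalAE (hN : IsPointProcess N) (hsimple : IsSimple P N)
    (hφ : ∀ i j, Measurable (φ i j))
    (hlam : ∀ i, IsConditionalIntensity P N i (intensity N ν φ i)) (hν : 0 < ν i)
    (hG : GrangerNoncausalAE P N i (intensity N ν φ j)) :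
    ∀ᵐ u, 0 < u → φ j i u ≤ 0 := by
  obtain ⟨t, ht⟩ := ((hlam j).ae_ae_lt_top hN.measurable).exists
  obtain ⟨g, hg, hlg⟩ := hG t
  let V : Set ℝ := {s | 0 < φ j i (t - s)}
  have hφt : Measurable fun s => φ j i (t - s) := (hφ j i).comp (measurable_const_sub t)
  have hV : MeasurableSet V := measurableSet_lt measurable_const hφt
  have hVnull : ∀ n : ℕ, volume (V ∩ Ioo (t - (n + 1)) t) = 0 := fun n => by
    by_contra hpos
    have hat : t - ((n : ℝ) + 1) < t := sub_lt_self t n.cast_add_one_pos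
    refine measure_apply_inter_noPoints_compl_ne_zero hN hsimple hφ hlam hν
      (hV.inter measurableSet_Ioo) inter_subset_right hpos (measure_eq_zero_iff_ae_notMem.2 ?_)
    filter_upwards [ae_setLIntegral_link_eq_zero hN hφ hlam hat ht hg hlg]
      with ω hω ⟨hcharge, hquiet⟩
    have hlink := hω hquiet i
    rw [lintegral_eq_zero_iff hφt.ennreal_ofReal, Filter.EventuallyEq,
      ae_restrict_iff' measurableSet_Ioo] at hlink
    refine hcharge (measure_mono_null ?_ hlink)
    exact fun s hs hzero => hs.1.not_ge (ENNReal.ofReal_eq_zero.1 (hzero hs.2))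
  have hVnull' : ∀ᵐ s, s < t → φ j i (t - s) ≤ 0 := by
    filter_upwards [ae_all_iff.2 fun n => measure_eq_zero_iff_ae_notMem.1 (hVnull n)] with s hs hst
    obtain ⟨n, hn⟩ := exists_nat_gt (t - s)
    exact not_lt.1 fun hpos => hs n ⟨hpos, by linarith, hst⟩
  filter_upwards [(Measure.measurePreserving_sub_left volume t).quasiMeasurePreserving.ae hVnull']
    with u hu hu0
  simpa using hu (sub_lt_self t hu0)

end LinkSupport

section Noncausality

variable {N : Fin d → Ω → Measure ℝ} {ν : Fin d → ℝ} {φ : Fin d → Fin d → ℝ → ℝ} {i j : Fin d}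
  {t : ℝ} {ω : Ω}

/-- The intensity of component `j` with the excitation by component `i` left out. It is the
candidate for an `F_{-i}(t-)`-measurable version of the intensity of `j`. -/
noncomputable def intensityWithout (N : Fin d → Ω → Measure ℝ) (ν : Fin d → ℝ)
    (φ : Fin d → Fin d → ℝ → ℝ) (i j : Fin d) (t : ℝ) (ω : Ω) : ℝ≥0∞ :=
  ENNReal.ofReal (ν j) +
    ∑ k ∈ Finset.univ.erase i, ∫⁻ s in Iio t, ENNReal.ofReal (φ j k (t - s)) ∂(N k ω)

theorem intensity_eq_intensityWithout_add : intensity N ν φ j t ω = intensityWithout N ν φ i j t ω +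
    ∫⁻ s in Iio t, ENNReal.ofReal (φ j i (t - s)) ∂(N i ω) := by
  rw [intensity, intensityWithout, add_assoc, Finset.sum_erase_add _ _ (Finset.mem_univ i)]

theorem measurable_historyLeft_intensityWithout (hφ : ∀ k, Measurable (φ j k)) :
    Measurable[historyLeft N {i}ᶜ t] (intensityWithout N ν φ i j t) := by
  let _ := historyLeft N {i}ᶜ t
  refine Measurable.const_add (f := fun ω => ∑ k ∈ Finset.univ.erase i,
    ∫⁻ s in Iio t, ENNReal.ofReal (φ j k (t - s)) ∂(N k ω)) ?_ _
  refine Finset.measurable_sum _ fun k hk => ?_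
  exact (Measure.measurable_lintegral
    ((hφ k).comp (measurable_const_sub t)).ennreal_ofReal).comp
    (measurable_restrict_historyLeft (Finset.ne_of_mem_erase hk))

theorem grangerNoncausal_of_link_nonpos (hφ : ∀ k, Measurable (φ j k))
    (h : ∀ u > 0, φ j i u ≤ 0) : GrangerNoncausal N i (intensity N ν φ j) := fun t => by
  have hlink : ∀ ω, ∫⁻ s in Iio t, ENNReal.ofReal (φ j i (t - s)) ∂(N i ω) = 0 := fun ω =>
    setLIntegral_eq_zero measurableSet_Iio fun s hs =>
      ENNReal.ofReal_of_nonpos (h _ (sub_pos.2 hs))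
  have hwithout : intensity N ν φ j t = intensityWithout N ν φ i j t := funext fun ω => by
    rw [intensity_eq_intensityWithout_add, hlink, add_zero]
  exact hwithout ▸ measurable_historyLeft_intensityWithout hφ

variable [MeasurableSpace Ω] {P : Measure Ω}

theorem GrangerNoncausal.ae {lam : ℝ → Ω → ℝ≥0∞} (h : GrangerNoncausal N i lam) :
    GrangerNoncausalAE P N i lam :=
  fun t => ⟨lam t, h t, Filter.EventuallyEq.rfl⟩

theorem grangerNoncausalAE_of_ae_link_nonpos (hN : ∀ k, Measurable (N k)) {lam : ℝ → Ω → ℝ≥0∞}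
    (hlam : IsConditionalIntensity P N i lam) (hφ : ∀ k, Measurable (φ j k))
    (h : ∀ᵐ u, 0 < u → φ j i u ≤ 0) : GrangerNoncausalAE P N i (intensity N ν φ j) := fun t => by
  refine ⟨intensityWithout N ν φ i j t, measurable_historyLeft_intensityWithout hφ, ?_⟩
  let V : Set ℝ := {s | s < t ∧ 0 < φ j i (t - s)}
  have hV : MeasurableSet V :=
    measurableSet_Iio.inter (measurableSet_lt measurable_const
      ((hφ i).comp (measurable_const_sub t)))
  have hVnull : volume V = 0 := measure_eq_zero_iff_ae_notMem.2 <| by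
    filter_upwards [(Measure.measurePreserving_sub_left volume t).quasiMeasurePreserving.ae h]
      with s hs hsV using (hs (sub_pos.2 hsV.1)).not_gt hsV.2
  filter_upwards [hlam.ae_apply_eq_zero hN hV hVnull] with ω hω
  have hlink : ∫⁻ s in Iio t, ENNReal.ofReal (φ j i (t - s)) ∂(N i ω) = 0 := by
    refine lintegral_eq_zero_of_ae_eq_zero ((ae_restrict_iff' measurableSet_Iio).2 ?_)
    filter_upwards [measure_eq_zero_iff_ae_notMem.1 hω] with s hs hst
    exact ENNReal.ofReal_of_nonpos (not_lt.1 fun hpos => hs ⟨hst, hpos⟩)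
  rw [intensity_eq_intensityWithout_add, hlink, add_zero]

end Noncausality

theorem eq_of_ae_eq_of_continuousWithinAt_Iic {Y : Type*} [TopologicalSpace Y] [T1Space Y]
    {f : ℝ → Y} (hf : ∀ u, ContinuousWithinAt f (Iic u) u) {c : Y} (h : ∀ᵐ u, f u = c) (u : ℝ) :
    f u = c := by
  by_contra hne
  obtain ⟨l, hlu, hsub⟩ := mem_nhdsLE_iff_exists_Ioc_subset.1 ((hf u).eventually_ne hne)
  have hnull : volume (Ioc l u) = 0 := measure_mono_null hsub h
  rw [Real.volume_Ioc, ENNReal.ofReal_eq_zero] at hnull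
  exact hnull.not_gt (sub_pos.2 hlu)

end Hawkes

theorem mainTheorem1_general {Ω : Type*} [MeasurableSpace Ω] {P : Measure Ω} [IsFiniteMeasure P]
    [NeZero P] {d : ℕ} {N : Fin d → Ω → Measure ℝ} {ν : Fin d → ℝ} {φ : Fin d → Fin d → ℝ → ℝ}
    (hN : Hawkes.IsPointProcess N) (hsimple : Hawkes.IsSimple P N) (hν : ∀ k, 0 < ν k)
    (hφ : ∀ k l, Measurable (φ k l)) (hφ_nonneg : ∀ k l u, 0 ≤ φ k l u)
    (hφ_zero : ∀ k l u, u ≤ 0 → φ k l u = 0)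
    (hlam : ∀ k, Hawkes.IsConditionalIntensity P N k (Hawkes.intensity N ν φ k)) (i j : Fin d) :
    ((∀ u : ℝ, ContinuousWithinAt (φ j i) (Iic u) u) →
      (Hawkes.GrangerNoncausal N i (Hawkes.intensity N ν φ j) ↔ ∀ u : ℝ, φ j i u = 0) ∧
      (Hawkes.GrangerNoncausalAE P N i (Hawkes.intensity N ν φ j) ↔ ∀ u : ℝ, φ j i u = 0)) ∧
    (Hawkes.GrangerNoncausalAE P N i (Hawkes.intensity N ν φ j) ↔
      ∀ᵐ u : ℝ, φ j i u = 0) := by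
  have hnull : Hawkes.GrangerNoncausalAE P N i (Hawkes.intensity N ν φ j) ↔
      ∀ᵐ u : ℝ, φ j i u = 0 := by
    refine ⟨fun hG => ?_, fun h => Hawkes.grangerNoncausalAE_of_ae_link_nonpos hN.measurable
      (hlam i) (hφ j) (h.mono fun _ hu _ => hu.le)⟩
    filter_upwards [Hawkes.ae_link_nonpos_of_grangerNoncausalAE hN hsimple hφ hlam (hν i) hG]
      with u hu
    exact (le_or_gt u 0).elim (hφ_zero j i u) fun hu0 => (hu hu0).antisymm (hφ_nonneg j i u)
  refine ⟨fun hcont => ?_, hnull⟩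
  have hzero : Hawkes.GrangerNoncausalAE P N i (Hawkes.intensity N ν φ j) →
      ∀ u, φ j i u = 0 :=
    fun hG => Hawkes.eq_of_ae_eq_of_continuousWithinAt_Iic hcont (hnull.1 hG)
  have hnoncausal : (∀ u, φ j i u = 0) →
      Hawkes.GrangerNoncausal N i (Hawkes.intensity N ν φ j) :=
    fun h => Hawkes.grangerNoncausal_of_link_nonpos (hφ j) fun u _ => (h u).le
  exact ⟨⟨fun hG => hzero hG.ae, hnoncausal⟩, hzero, fun h => (hnoncausal h).ae⟩

theorem mainTheorem1 {Ω : Type*} [MeasurableSpace Ω] (P : Measure Ω) [IsProbabilityMeasure P]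
    {d : ℕ} (N : Fin d → Ω → Measure ℝ) (ν : Fin d → ℝ) (φ : Fin d → Fin d → ℝ → ℝ)
    (hN : Hawkes.IsHawkesProcess P N ν φ) (i j : Fin d) :
    ((∀ u : ℝ, ContinuousWithinAt (φ j i) (Iic u) u) →
      (Hawkes.GrangerNoncausal N i (Hawkes.intensity N ν φ j) ↔ ∀ u : ℝ, φ j i u = 0) ∧
      (Hawkes.GrangerNoncausalAE P N i (Hawkes.intensity N ν φ j) ↔ ∀ u : ℝ, φ j i u = 0)) ∧
    (Hawkes.GrangerNoncausalAE P N i (Hawkes.intensity N ν φ j) ↔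
      ∀ᵐ u : ℝ, φ j i u = 0) :=
  mainTheorem1_general hN.pointProcess hN.simple hN.baseline_pos hN.link_measurable
    hN.link_nonneg hN.link_eq_zero hN.conditionalIntensity i j
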